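/- **Setting.** Let $G=(V,E,w)$ be a finite undirected graph with $n=|V|$ vertices and weights $w:E\to\mathbb R_{\ge 0}$. Write $\delta_G$ for its shortest-path distance ($\infty$ between different components) and $\delta_G(u,S)=\min_{s\in S}\delta_G(u,s)$, with $\delta_G(u,\varnothing)=\infty$. For a shortest path $P$ from $u$ to $v$, let $W_i(P)$ be the weight of its $i$-th heaviest edge ($0$ if $P$ has fewer than $i$ edges). A weighted graph $H=(V,F,w_H)$ is an $(\alpha,\beta)$-emulator of $G$, where $\beta$ may depend on a path, if for all $u,v\in V$ we have $\delta_G(u,v)\le\delta_H(u,v)$, and $\delta_H(u,v)\le\alpha\,\delta_G(u,v)+\beta(P)$ for every shortest path $P$ from $u$ to $v$ in $G$. **Construction.** Let $k\ge 2$ be an integer. Put $S_0=V$ and $S_k=\varnothing$. For $1\le i\le k-1$, each vertex of $S_{i-1}$ is put into $S_i$ independently with probability $n^{-1/k}$. For every $u\in V$ and every $1\le i\le k-1$ with $S_i\neq\varnothing$, let the pivot $p_i(u)\in S_i$ be a vertex with $\delta_G(u,p_i(u))=\delta_G(u,S_i)$; ties are broken by any fixed rule depending only on $u$ and $S_i$.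 Define - $D=\{(u,p_i(u)) : u\in V,\ 1\le i\le k-1,\ S_i\ne\varnothing\}$; - $E_1=\{(u,v)\in E : w(u,v)<\delta_G(u,S_1)\}$; - $B_j(A)=\{(u,s) : u\in A,\ \exists\, i\ge 0 \text{ with } i+j\le k-1,\ s\in S_i,\ \delta_G(u,s)<\delta_G(u,S_{i+j})\}$ for $A\subseteq V$. Let $$F=D\cup E_1\cup B_1(V)\cup B_2(S_1)\cup\bigcup_{i=1}^{k}\left(S_{i-1}\times S_{k-i}\right),$$ regarded as a set of unordered pairs, omitting pairs at infinite distance. Put $w_H(u,v)=\delta_G(u,v)$ for $(u,v)\in F$, and $H=(V,F,w_H)$. **Theorem.** For every integer $k\ge2$ and every such graph $G$: 1. For every outcome of the sampling, $H$ is a $$\left(2\left\lfloor\tfrac k2\right\rfloor-1,\ 2\left\lceil\tfrac k2\right\rceil W_1+\max\left\{0,\,2\left(\left\lceil\tfrac k2\right\rceil-2\right)\right\}W_2\right)\text{-emulator}$$ of $G$. For even $k\ge4$ this is $(k-1,\ kW_1+(k-4)W_2)$, and for odd $k$ it is $(k-2,\ (k+1)W_1+(k-3)W_2)$. 2. The expected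 size of $H$ is $\tilde O(n^{1+1/k})$. Precisely, there are absolute constants $C,c$ such that for all $k\ge 2$ and all such $G$, $$\mathbb E\,|F|\le C\,k\,(1+\log n)^{c}\,n^{1+1/k}\quad (n\ge 1).$$ -/

import Mathlib

open scoped NNReal ENNReal

noncomputable section

namespace Emulator

variable {V : Type*}

/-! ### Weighted graphs

A weighted undirected graph is a simple graph `G` together with a nonnegative weight function on
unordered pairs; only the weights of the edges of `G` play a role. Loops are irrelevant for
distances. -/

/-- The weight of a path (a sequence of consecutively adjacent vertices). -/
def pathWeight {G : SimpleGraph V} (w : Sym2 V → ℝ≥0) {u v : V} (P : G.Walk u v) : ℝ≥0 :=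
  (P.edges.map w).sum

/-- The distance `δ(u, v)`, which is `∞` if `v` cannot be reached from `u`. -/
def dist (G : SimpleGraph V) (w : Sym2 V → ℝ≥0) (u v : V) : ℝ≥0∞ :=
  ⨅ P : G.Walk u v, (pathWeight w P : ℝ≥0∞)

/-- `P` is a shortest path between its endpoints. -/
def IsShortestPath (G : SimpleGraph V) (w : Sym2 V → ℝ≥0) {u v : V} (P : G.Walk u v) : Prop :=
  (pathWeight w P : ℝ≥0∞) = dist G w u v

/-- `W_i(P)`: the weight of the `i`-th heaviest edge of `P`, counted with multiplicity
(`i = 1, 2, …`), and `0` if `P` has fewer than `i` edges. -/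
def heaviest {G : SimpleGraph V} (w : Sym2 V → ℝ≥0) (i : ℕ) {u v : V} (P : G.Walk u v) : ℝ≥0 :=
  ((P.edges.map w).insertionSort (fun a b => b ≤ a)).getD (i - 1) 0

/-- The weighted graph on `V` with edge set `F` and weights `wH` is an `(α, β)`-emulator of
`(G, w)`: its distances never fall below those of `G`, and for all `u`, `v` and every shortest path
`P` between them in `G`, they are at most `α · δ_G(u, v) + β(P)`. -/
def IsEmulator (G : SimpleGraph V) (w : Sym2 V → ℝ≥0) (F : Set (Sym2 V)) (wH : Sym2 V → ℝ≥0)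
    (α : ℝ) (β : ∀ ⦃u v : V⦄, G.Walk u v → ℝ) : Prop :=
  ∀ u v : V,
    dist G w u v ≤ dist (SimpleGraph.fromEdgeSet F) wH u v ∧
    ∀ P : G.Walk u v, IsShortestPath G w P →
      dist (SimpleGraph.fromEdgeSet F) wH u v ≤
        ENNReal.ofReal α * dist G w u v + ENNReal.ofReal (β P)

theorem dist_le_symm (G : SimpleGraph V) (w : Sym2 V → ℝ≥0) (u v : V) :
    dist G w u v ≤ dist G w v u := by
  refine le_iInf fun P => (iInf_le _ P.reverse).trans (le_of_eq ?_)
  simp [pathWeight, SimpleGraph.Walk.edges_reverse, List.sum_reverse]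

theorem dist_symm (G : SimpleGraph V) (w : Sym2 V → ℝ≥0) (u v : V) :
    dist G w u v = dist G w v u :=
  le_antisymm (dist_le_symm G w u v) (dist_le_symm G w v u)

/-! ### Pivots, balls and bunches -/

/-- The distance `δ(u, S)` from a vertex to a set, which is `∞` if `S` is empty. -/
def distSet (G : SimpleGraph V) (w : Sym2 V → ℝ≥0) (u : V) (S : Set V) : ℝ≥0∞ :=
  ⨅ s ∈ S, dist G w u s

/-- `p S u` is, for every nonempty `S`, a pivot of `u` with respect to `S`: a member of `S` closest
to `u`. The function `p` fixes how ties are broken. -/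
def IsPivotRule (G : SimpleGraph V) (w : Sym2 V → ℝ≥0) (p : Set V → V → V) : Prop :=
  ∀ S : Set V, S.Nonempty → ∀ u : V, p S u ∈ S ∧ dist G w u (p S u) = distSet G w u S

/-- The ball of `u` restricted to `A`: the members of `A` that are strictly closer to `u` than the
pivot of `u` with respect to `S`. -/
def ball (G : SimpleGraph V) (w : Sym2 V → ℝ≥0) (u : V) (A S : Set V) : Set V :=
  {a | a ∈ A ∧ dist G w u a < distSet G w u S}

/-- `E_S`: the edges of `G` that are, for one of their endpoints `u`, strictly lighter than the
distance from `u` to its pivot with respect to `S`. -/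
def lightEdges (G : SimpleGraph V) (w : Sym2 V → ℝ≥0) (S : Set V) : Set (Sym2 V) :=
  {e | ∃ u v : V, e = s(u, v) ∧ G.Adj u v ∧ (w s(u, v) : ℝ≥0∞) < distSet G w u S}

/-- The auxiliary edges `D = D_1 ∪ … ∪ D_{k-1}` between vertices and their pivots. -/
def pivotEdges (p : Set V → V → V) (k : ℕ) (S : ℕ → Set V) : Set (Sym2 V) :=
  {e | ∃ i ∈ Finset.Icc 1 (k - 1), (S i).Nonempty ∧ ∃ u : V, e = s(u, p (S i) u)}

/-- The bunch edges `B_j(A)`: pairs of a vertex `u ∈ A` and a vertex `s ∈ S_i` in the ball of `u`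
with respect to `S_{i+j}`, where `0 ≤ i` and `i + j ≤ k - 1`. -/
def bunchEdges (G : SimpleGraph V) (w : Sym2 V → ℝ≥0) (k : ℕ) (S : ℕ → Set V) (j : ℕ)
    (A : Set V) : Set (Sym2 V) :=
  {e | ∃ u ∈ A, ∃ i : ℕ, i + j ≤ k - 1 ∧ ∃ s ∈ ball G w u (S i) (S (i + j)), e = s(u, s)}

/-- The union of the products `S_{i-1} × S_{k-i}` for `1 ≤ i ≤ k`. -/
def productEdges (k : ℕ) (S : ℕ → Set V) : Set (Sym2 V) :=
  {e | ∃ i ∈ Finset.Icc 1 k, ∃ u ∈ S (i - 1), ∃ v ∈ S (k - i), e = s(u, v)}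

/-- The exact distance of `G` as a function of an unordered pair. It serves as the weight function
of the emulator and is used only on pairs at finite distance. -/
def distWeight (G : SimpleGraph V) (w : Sym2 V → ℝ≥0) : Sym2 V → ℝ≥0 :=
  Sym2.lift ⟨fun u v => (dist G w u v).toNNReal, fun u v => congrArg ENNReal.toNNReal (dist_symm G w u v)⟩

/-- The pairs of vertices at finite distance. (All pairs, if `G` is connected.) -/
def finitePairs (G : SimpleGraph V) (w : Sym2 V → ℝ≥0) : Set (Sym2 V) :=
  {e | ∃ u v : V, e = s(u, v) ∧ dist G w u v ≠ ∞}

/-- The edge set `F = D ∪ E_1 ∪ B_1(V) ∪ B_2(S_1) ∪ ⋃ S_{i-1} × S_{k-i}` of the emulator. A pair in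
distinct components of `G` cannot carry its (infinite) distance as a weight and is left out. -/
def emulatorEdges (G : SimpleGraph V) (w : Sym2 V → ℝ≥0) (p : Set V → V → V) (k : ℕ)
    (S : ℕ → Set V) : Set (Sym2 V) :=
  (pivotEdges p k S ∪ lightEdges G w (S 1) ∪ bunchEdges G w k S 1 Set.univ ∪
    bunchEdges G w k S 2 (S 1) ∪ productEdges k S) ∩ finitePairs G w

/-! ### The sampled hierarchy -/

/-- The outcomes of the coins tossed by the construction: one coin for each level
`i = 1, …, k - 1` (indexed by `i - 1`) and each vertex. -/
abbrev Coins (k : ℕ) (V : Type*) : Type _ := Fin (k - 1) × V → Bool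

/-- The hierarchy `V = S_0 ⊇ S_1 ⊇ … ⊇ S_{k-1} ⊇ S_k = ∅`: a vertex of `S_{i-1}` enters `S_i`, for
`1 ≤ i ≤ k - 1`, if its coin of level `i` shows `true`. -/
def hierarchy (k : ℕ) (ω : Coins k V) : ℕ → Set V
  | 0 => Set.univ
  | i + 1 => {v | v ∈ hierarchy k ω i ∧ ∃ h : i < k - 1, ω (⟨i, h⟩, v) = true}

theorem samplingProb_mem (n k : ℕ) : (n : ℝ) ^ (-(1 / (k : ℝ))) ∈ Set.Icc (0 : ℝ) 1 := by
  refine ⟨Real.rpow_nonneg (Nat.cast_nonneg n) _, ?_⟩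
  rcases Nat.eq_zero_or_pos n with rfl | hn
  · rcases Nat.eq_zero_or_pos k with rfl | hk
    · simp
    · have h : (-(1 / (k : ℝ))) ≠ 0 := by
        have h0 : (0 : ℝ) < k := by exact_mod_cast hk
        have := one_div_pos.mpr h0
        linarith
      rw [Nat.cast_zero, Real.zero_rpow h]
      exact zero_le_one
  · exact Real.rpow_le_one_of_one_le_of_nonpos (by exact_mod_cast hn)
      (neg_nonpos.mpr (by positivity))

/-- The sampling probability `q = n^{-1/k}`. -/
def samplingProb (n k : ℕ) : unitInterval := ⟨(n : ℝ) ^ (-(1 / (k : ℝ))), samplingProb_mem n k⟩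

/-- The law of the coins: they are independent, and each shows `true` with probability
`n^{-1/k}`, where `n` is the number of vertices. -/
def coinLaw (k : ℕ) (V : Type*) [Fintype V] : MeasureTheory.Measure (Coins k V) :=
  MeasureTheory.Measure.pi fun _ =>
    ProbabilityTheory.bernoulliMeasure true false (samplingProb (Fintype.card V) k)

end Emulator

end

/-! Stretch. A vertex `x` that knows some `s` in `S_l` within distance `r` is either joined to `s`
in `H` (`s` lies in the bunch) or joined to a pivot in `S_{l+1}` within `r`. If both ends of a
segment of length `D` climb in this way, each level raises the search radius by `D`, and any failure
to climb closes a route. This is `dist_le_or_exists_level`. The products `S_i × S_{k-1-i}` close the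
route at the top. Vertices of `S_1` climb two levels per step, thanks to `B_2(S_1)`, which roughly
halves the stretch.

To reach `S_1`, call an edge heavy if `H` does not already realise its weight. Both ends of a heavy
edge have a pivot in `S_1` no farther than that weight. A path is cut at its first and last heavy
edge, of weights `a` and `b` (`dist_le_of_walk`): the outer parts cost nothing extra, and the middle
is routed between vertices of `S_1`, or from `S_1` to an end of the last heavy edge. The detours
cost multiples of `a` and `b`, which are at most `W_1` each and at most `W_1 + W_2` together. A
single heavy edge is crossed with stretch `2k - 1`; that excess is shared between the path weight
and `W_1`. The parity of `k` decides which levels can be paired, hence `dist_le_of_odd` and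
`dist_le_of_even`.

Size. Order the vertices by distance from `u`. The event that `s` is in `S_i` and no earlier vertex
is in `S_{i+j}` does not involve the coins that lift `s` from `S_i` to `S_{i+j}`. Requiring these to
succeed multiplies its probability by `q^j` and makes the events disjoint, since `s` is then the
first member of `S_{i+j}`. So a ball has expected size at most `q^{-j}`, up to the term for `u`
itself (`sum_coinLaw_mul_le`, `sum_coinLaw_ball_le`). -/

namespace Emulator

section

variable {V : Type*}

/-! ### Distances -/

theorem dist_le_pathWeight (G : SimpleGraph V) (w : Sym2 V → ℝ≥0) {u v : V} (P : G.Walk u v) :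
    dist G w u v ≤ pathWeight w P :=
  iInf_le _ P

theorem dist_self (G : SimpleGraph V) (w : Sym2 V → ℝ≥0) (u : V) : dist G w u u = 0 :=
  le_antisymm ((dist_le_pathWeight G w SimpleGraph.Walk.nil).trans (by simp [pathWeight]))
    zero_le

theorem pathWeight_append {G : SimpleGraph V} (w : Sym2 V → ℝ≥0) {a b c : V} (P : G.Walk a b)
    (Q : G.Walk b c) : pathWeight w (P.append Q) = pathWeight w P + pathWeight w Q := by
  simp [pathWeight, SimpleGraph.Walk.edges_append]

theorem pathWeight_cons {G : SimpleGraph V} (w : Sym2 V → ℝ≥0) {a b c : V} (h : G.Adj a b)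
    (Q : G.Walk b c) :
    pathWeight w (SimpleGraph.Walk.cons h Q) = w s(a, b) + pathWeight w Q := by
  simp [pathWeight]

theorem dist_triangle (G : SimpleGraph V) (w : Sym2 V → ℝ≥0) (a b c : V) :
    dist G w a c ≤ dist G w a b + dist G w b c := by
  simp only [dist, ENNReal.iInf_add, ENNReal.add_iInf]
  refine le_iInf₂ fun P Q => (iInf_le _ (Q.append P)).trans (le_of_eq ?_)
  simp [pathWeight_append]

theorem dist_le_add {G : SimpleGraph V} {w : Sym2 V → ℝ≥0} {a b c : V} {r s : ℝ≥0}
    (h₁ : dist G w a b ≤ r) (h₂ : dist G w b c ≤ s) : dist G w a c ≤ (r + s : ℝ≥0) := by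
  rw [ENNReal.coe_add]
  exact (dist_triangle G w a b c).trans (add_le_add h₁ h₂)

theorem dist_le_comm {G : SimpleGraph V} {w : Sym2 V → ℝ≥0} {a b : V} {r : ℝ≥0∞}
    (h : dist G w a b ≤ r) : dist G w b a ≤ r :=
  (dist_le_symm G w b a).trans h

theorem dist_le_of_adj {G : SimpleGraph V} (w : Sym2 V → ℝ≥0) {a b : V} (h : G.Adj a b) :
    dist G w a b ≤ w s(a, b) :=
  (dist_le_pathWeight G w h.toWalk).trans (by simp [pathWeight])

theorem dist_le_of_forall_edge {G H : SimpleGraph V} {w wH : Sym2 V → ℝ≥0} {u v : V}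
    (P : G.Walk u v)
    (h : ∀ a b, s(a, b) ∈ P.edges → dist H wH a b ≤ w s(a, b)) :
    dist H wH u v ≤ pathWeight w P := by
  induction P with
  | nil => simp [dist_self]
  | cons hab Q ih =>
    rw [pathWeight_cons]
    exact dist_le_add (h _ _ (by simp)) (ih fun a b hm => h a b (by simp [hm]))

theorem coe_distWeight {G : SimpleGraph V} {w : Sym2 V → ℝ≥0} {a b : V}
    (h : dist G w a b ≠ ∞) : (distWeight G w s(a, b) : ℝ≥0∞) = dist G w a b := by
  simp [distWeight, ENNReal.coe_toNNReal h]

theorem dist_le_dist_fromEdgeSet {G : SimpleGraph V} {w : Sym2 V → ℝ≥0} {F : Set (Sym2 V)}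
    (hF : F ⊆ finitePairs G w) (u v : V) :
    dist G w u v ≤ dist (SimpleGraph.fromEdgeSet F) (distWeight G w) u v := by
  refine le_iInf fun P => ?_
  refine dist_le_of_forall_edge P fun a b hab => ?_
  have hm := P.edges_subset_edgeSet hab
  rw [SimpleGraph.mem_edgeSet, SimpleGraph.fromEdgeSet_adj] at hm
  obtain ⟨x, y, hxy, hfin⟩ := hF hm.1
  have hfin' : dist G w a b ≠ ∞ := by
    rcases Sym2.eq_iff.1 hxy with ⟨rfl, rfl⟩ | ⟨rfl, rfl⟩
    · exact hfin
    · rwa [dist_symm]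
  exact (coe_distWeight hfin').ge

theorem dist_fromEdgeSet_le {G : SimpleGraph V} {w : Sym2 V → ℝ≥0} {F : Set (Sym2 V)} {a b : V}
    (h : s(a, b) ∈ F) :
    dist (SimpleGraph.fromEdgeSet (F ∩ finitePairs G w)) (distWeight G w) a b ≤ dist G w a b := by
  -- Pairs at infinite distance and loops are not edges of `H`, but the bound is trivial for both.
  by_cases hfin : dist G w a b = ∞
  · simp [hfin]
  by_cases hab : a = b
  · subst hab
    simp [dist_self]
  rw [← coe_distWeight hfin]
  exact dist_le_of_adj _ ((SimpleGraph.fromEdgeSet_adj _).2 ⟨⟨h, a, b, rfl, hfin⟩, hab⟩)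

theorem distSet_le {G : SimpleGraph V} {w : Sym2 V → ℝ≥0} {u s : V} {S : Set V} (hs : s ∈ S) :
    distSet G w u S ≤ dist G w u s :=
  iInf₂_le s hs

theorem IsPivotRule.exists_pivot {G : SimpleGraph V} {w : Sym2 V → ℝ≥0} {p : Set V → V → V}
    (hp : IsPivotRule G w p) {u : V} {S : Set V} {r : ℝ≥0} (h : distSet G w u S ≤ r) :
    S.Nonempty ∧ p S u ∈ S ∧ dist G w u (p S u) ≤ r := by
  have hne : S.Nonempty := by
    by_contra hS
    rw [Set.not_nonempty_iff_eq_empty] at hS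
    subst hS
    simp [distSet] at h
  exact ⟨hne, (hp S hne u).1, (hp S hne u).2.trans_le h⟩

/-! ### Walks -/

theorem exists_first_notMem {G : SimpleGraph V} (L : Set (Sym2 V)) {u v : V} (P : G.Walk u v) :
    (∀ e ∈ P.edges, e ∈ L) ∨
      ∃ (x x' : V) (P₁ : G.Walk u x) (h : G.Adj x x') (P₂ : G.Walk x' v),
        P = P₁.append (SimpleGraph.Walk.cons h P₂) ∧ (∀ e ∈ P₁.edges, e ∈ L) ∧ s(x, x') ∉ L := by
  induction P with
  | nil => simp
  | @cons a b c hab Q ih =>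
    by_cases he : s(a, b) ∈ L
    · rcases ih with ih | ⟨x, x', P₁, h, P₂, rfl, hP₁, hx⟩
      · left
        simpa [he] using ih
      · exact .inr ⟨x, x', .cons hab P₁, h, P₂, rfl, by simpa [he] using hP₁, hx⟩
    · exact .inr ⟨a, b, .nil, hab, Q, rfl, by simp, he⟩

theorem exists_last_notMem {G : SimpleGraph V} (L : Set (Sym2 V)) {u v : V} (P : G.Walk u v) :
    (∀ e ∈ P.edges, e ∈ L) ∨
      ∃ (y' y : V) (P₁ : G.Walk u y') (h : G.Adj y' y) (P₂ : G.Walk y v),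
        P = P₁.append (SimpleGraph.Walk.cons h P₂) ∧ (∀ e ∈ P₂.edges, e ∈ L) ∧ s(y', y) ∉ L := by
  induction P with
  | nil => simp
  | @cons a b c hab Q ih =>
    rcases ih with ih | ⟨x, x', P₁, h, P₂, rfl, hP₁, hx⟩
    · by_cases he : s(a, b) ∈ L
      · left
        simpa [he] using ih
      · exact .inr ⟨a, b, .nil, hab, Q, rfl, ih, he⟩
    · exact .inr ⟨x, x', .cons hab P₁, h, P₂, rfl, hP₁, hx⟩

/-! ### Heaviest edges of a path -/

theorem getD_zero_insertionSort_ge {l : List ℝ≥0} {a : ℝ≥0} (h : a ∈ l) :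
    a ≤ (l.insertionSort fun a b => b ≤ a).getD 0 0 := by
  have hs := List.pairwise_insertionSort (fun a b : ℝ≥0 => b ≤ a) l
  have hm : a ∈ l.insertionSort fun a b => b ≤ a :=
    (List.perm_insertionSort _ l).mem_iff.2 h
  generalize l.insertionSort (fun a b => b ≤ a) = m at hs hm
  rcases m with _ | ⟨b, m⟩
  · simp at hm
  · rcases List.mem_cons.1 hm with rfl | hm
    · exact le_rfl
    · exact (List.pairwise_cons.1 hs).1 a hm

/-- A sublist occupies two distinct positions, so equal values are counted with multiplicity.
Sorting may swap the two entries, which is why both orders are treated. -/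
theorem add_le_of_sublist {l : List ℝ≥0} {a b : ℝ≥0} (h : List.Sublist [a, b] l) :
    a + b ≤ (l.insertionSort fun a b => b ≤ a).getD 0 0 +
      (l.insertionSort fun a b => b ≤ a).getD 1 0 := by
  have hs := List.pairwise_insertionSort (fun a b : ℝ≥0 => b ≤ a) l
  have hm : List.Subperm [a, b] (l.insertionSort fun a b => b ≤ a) :=
    h.subperm.trans (List.perm_insertionSort _ l).symm.subperm
  generalize l.insertionSort (fun a b => b ≤ a) = m at hs hm
  obtain ⟨m', hperm, hsub⟩ := hm
  have hs' := hs.sublist hsub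
  have key : ∀ x y : ℝ≥0, List.Sublist [x, y] m → x + y ≤ m.getD 0 0 + m.getD 1 0 := by
    intro x y hxy
    rcases m with _ | ⟨c, m⟩
    · simp at hxy
    rcases m with _ | ⟨d, m⟩
    · exact absurd hxy.length_le (by simp)
    · have hx : x ∈ c :: d :: m := hxy.subset (by simp)
      have hy : y ∈ d :: m := by
        cases hxy with
        | cons _ h => exact h.subset (by simp)
        | cons_cons _ h => exact h.subset (by simp)
      refine add_le_add ?_ ?_
      · rcases List.mem_cons.1 hx with rfl | hx
        · exact le_rfl
        · exact (List.pairwise_cons.1 hs).1 x hx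
      · rcases List.mem_cons.1 hy with rfl | hy
        · exact le_rfl
        · exact (List.pairwise_cons.1 (List.pairwise_cons.1 hs).2).1 y hy
  have hlen : m' = [a, b] ∨ m' = [b, a] := by
    rcases m' with _ | ⟨x, _ | ⟨y, _ | ⟨z, m'⟩⟩⟩
    · simpa using hperm.length_eq
    · simpa using hperm.length_eq
    · have hx : x = a ∨ x = b := by simpa using hperm.subset (show x ∈ [x, y] by simp)
      rcases hx with rfl | rfl
      · left
        simpa using hperm
      · right
        have := hperm.trans (List.Perm.swap _ _ _)
        simpa using this
    · simpa using hperm.length_eq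
  rcases hlen with rfl | rfl
  · exact key a b hsub
  · rw [add_comm]
    exact key b a hsub

theorem le_heaviest_one {G : SimpleGraph V} (w : Sym2 V → ℝ≥0) {u v : V} {P : G.Walk u v}
    {e : Sym2 V} (he : e ∈ P.edges) : w e ≤ heaviest w 1 P :=
  getD_zero_insertionSort_ge (List.mem_map_of_mem he)

theorem add_le_heaviest {G : SimpleGraph V} (w : Sym2 V → ℝ≥0) {u v : V} {P : G.Walk u v}
    {e f : Sym2 V} (h : List.Sublist [e, f] P.edges) :
    w e + w f ≤ heaviest w 1 P + heaviest w 2 P :=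
  add_le_of_sublist (h.map w)

end

section

variable {V : Type*}

/-! ### Stretch -/

/-- The properties of the emulator `(H, wH)` of `(G, w)` with respect to the hierarchy `S` on which
the analysis of its stretch rests. -/
structure HierarchyLinks (G : SimpleGraph V) (w : Sym2 V → ℝ≥0) (H : SimpleGraph V)
    (wH : Sym2 V → ℝ≥0) (k : ℕ) (S : ℕ → Set V) : Prop where
  mem_zero : ∀ v, v ∈ S 0
  le : ∀ u v, dist G w u v ≤ dist H wH u v
  step_one : ∀ (x : V) (l : ℕ) (r : ℝ≥0) (s : V), l + 1 ≤ k - 1 → s ∈ S l → dist G w x s ≤ r →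
    dist H wH x s ≤ r ∨ ∃ t ∈ S (l + 1), dist H wH x t ≤ r
  step_two : ∀ x ∈ S 1, ∀ (l : ℕ) (r : ℝ≥0) (s : V), l + 2 ≤ k - 1 → s ∈ S l →
    dist G w x s ≤ r → dist H wH x s ≤ r ∨ ∃ t ∈ S (l + 2), dist H wH x t ≤ r
  product : ∀ i j, i + j = k - 1 → ∀ a ∈ S i, ∀ b ∈ S j, dist H wH a b ≤ dist G w a b
  edge : ∀ u v, G.Adj u v → dist H wH u v ≤ w s(u, v) ∨
    (∃ t ∈ S 1, dist H wH u t ≤ w s(u, v)) ∧ ∃ t ∈ S 1, dist H wH v t ≤ w s(u, v)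

variable {G H : SimpleGraph V} {w wH : Sym2 V → ℝ≥0} {k : ℕ} {S : ℕ → Set V}

/-- Both ends climb together. The vertex of `T N` found by one end is within `(N + 1) * D` of the
other, which then either links to it, closing a route of length `N * D + (N + 1) * D`, or reaches
level `N + 1`. The sequence `T` is left free so that it can skip levels of the hierarchy. -/
theorem dist_le_or_exists_level {T : ℕ → Set V} {z z' : V} {D : ℝ≥0}
    (hle : ∀ u v, dist G w u v ≤ dist H wH u v) (hD : dist G w z z' ≤ D) (N : ℕ)
    (hz : z ∈ T 0) (hz' : z' ∈ T 0)
    (hstep : ∀ x, x = z ∨ x = z' → ∀ i < N, ∀ (r : ℝ≥0) (s : V), s ∈ T i → dist G w x s ≤ r →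
      dist H wH x s ≤ r ∨ ∃ t ∈ T (i + 1), dist H wH x t ≤ r) :
    dist H wH z z' ≤ ((2 * N + 1) * D : ℝ≥0) ∨
      (∃ s ∈ T N, dist H wH z s ≤ (N * D : ℝ≥0)) ∧ ∃ s ∈ T N, dist H wH z' s ≤ (N * D : ℝ≥0) := by
  induction N with
  | zero =>
    exact .inr ⟨⟨z, hz, by simp [dist_self]⟩, z', hz', by simp [dist_self]⟩
  | succ N ih =>
    have e : ((N + 1 : ℕ) : ℝ≥0) * D = D + N * D := by
      push_cast
      ring
    rcases ih fun x hx i hi => hstep x hx i (by omega) with h | ⟨⟨s, hs, hzs⟩, s', hs', hzs'⟩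
    · left
      refine h.trans (ENNReal.coe_le_coe.2 (mul_le_mul_left ?_ D))
      push_cast
      gcongr
      simp
    · have h₁ : dist G w z' s ≤ (D + N * D : ℝ≥0) :=
        dist_le_add (dist_le_comm hD) ((hle _ _).trans hzs)
      have h₂ : dist G w z s' ≤ (D + N * D : ℝ≥0) := dist_le_add hD ((hle _ _).trans hzs')
      have fin : ∀ r : ℝ≥0, r = N * D + (D + N * D) → r ≤ (2 * (N + 1 : ℕ) + 1) * D := by
        rintro r rfl
        have : (2 * ((N + 1 : ℕ) : ℝ≥0) + 1) * D = N * D + (D + N * D) + 2 * D := by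
          push_cast
          ring
        rw [this]
        exact le_self_add
      rcases hstep z' (.inr rfl) N (by omega) _ s hs h₁ with h | h
      · left
        exact (dist_le_add hzs (dist_le_comm h)).trans (ENNReal.coe_le_coe.2 (fin _ rfl))
      · rcases hstep z (.inl rfl) N (by omega) _ s' hs' h₂ with h' | h'
        · left
          exact (dist_le_add h' (dist_le_comm hzs')).trans
            (ENNReal.coe_le_coe.2 (fin _ (add_comm _ _)))
        · right
          rw [e]
          exact ⟨h', h⟩

namespace HierarchyLinks

theorem dist_le_two_mul_sub_one (hS : HierarchyLinks G w H wH k S) {x x' : V}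
    {D : ℝ≥0} (hD : dist G w x x' ≤ D) :
    dist H wH x x' ≤ ((2 * (k - 1 : ℕ) + 1) * D : ℝ≥0) := by
  rcases dist_le_or_exists_level (T := S) hS.le hD (k - 1) (hS.mem_zero _) (hS.mem_zero _)
    (fun x _ i hi r s hs h => hS.step_one x i r s (by omega) hs h) with h | ⟨⟨s, hs, h⟩, -⟩
  · exact h
  · have h' : dist G w s x' ≤ ((k - 1 : ℕ) * D + D : ℝ≥0) :=
      dist_le_add (dist_le_comm ((hS.le _ _).trans h)) hD
    refine (dist_le_add h ((hS.product _ 0 rfl s hs x' (hS.mem_zero _)).trans h')).trans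
      (le_of_eq ?_)
    congr 1
    ring

/-- Starting in `S 1`, two-level steps visit exactly the odd levels. -/
theorem dist_le_or_exists_odd_level (hS : HierarchyLinks G w H wH k S) {z z' : V} {D : ℝ≥0}
    (hz : z ∈ S 1) (hz' : z' ∈ S 1) (hD : dist G w z z' ≤ D) {N : ℕ} (hN : 2 * N + 1 ≤ k - 1) :
    dist H wH z z' ≤ ((2 * N + 1) * D : ℝ≥0) ∨
      ∃ s ∈ S (2 * N + 1), dist H wH z' s ≤ (N * D : ℝ≥0) := by
  refine (dist_le_or_exists_level (T := fun i => S (2 * i + 1)) hS.le hD N hz hz' ?_).imp_right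
    And.right
  rintro x hx i hi r s hs h
  refine hS.step_two x ?_ (2 * i + 1) r s (by omega) hs h
  rcases hx with rfl | rfl <;> assumption

theorem dist_le_of_odd {m : ℕ} (hS : HierarchyLinks G w H wH (2 * m + 3) S) {z z' : V} {D : ℝ≥0}
    (hz : z ∈ S 1) (hz' : z' ∈ S 1) (hD : dist G w z z' ≤ D) :
    dist H wH z z' ≤ ((2 * m + 1) * D : ℝ≥0) := by
  rcases hS.dist_le_or_exists_odd_level hz hz' hD (N := m) (by omega) with h | ⟨s, hs, h⟩
  · exact h
  -- Here `k - 1 = 2 * m + 2`, so level `2 * m + 1` pairs with level `1`, where `z` itself lies.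
  · have h' : dist G w z s ≤ (D + m * D : ℝ≥0) := dist_le_add hD ((hS.le _ _).trans h)
    refine (dist_le_add ((hS.product 1 (2 * m + 1) (by omega) z hz s hs).trans h')
      (dist_le_comm h)).trans (le_of_eq ?_)
    congr 1
    ring

theorem dist_le_of_two (hS : HierarchyLinks G w H wH 2 S) {z y : V} {D : ℝ≥0} (hz : z ∈ S 1)
    (hD : dist G w z y ≤ D) : dist H wH z y ≤ D :=
  (hS.product 1 0 rfl z hz y (hS.mem_zero y)).trans hD

theorem dist_le_or_exists_two (hS : HierarchyLinks G w H wH k S) (hk : 3 ≤ k) {z y : V} {D : ℝ≥0}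
    (hz : z ∈ S 1) (hD : dist G w z y ≤ D) :
    dist H wH z y ≤ D ∨ ∃ t ∈ S 2, dist H wH y t ≤ D :=
  (hS.step_one y 1 D z (by omega) hz (dist_le_comm hD)).imp_left dist_le_comm

theorem dist_le_of_four (hS : HierarchyLinks G w H wH 4 S) {z y : V} {D : ℝ≥0} (hz : z ∈ S 1)
    (hD : dist G w z y ≤ D) : dist H wH z y ≤ (3 * D : ℝ≥0) := by
  rcases hS.dist_le_or_exists_two (by omega) hz hD with h | ⟨t, ht, h⟩
  · refine h.trans (ENNReal.coe_le_coe.2 ?_)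
    rw [show 3 * D = D + 2 * D by ring]
    exact le_self_add
  · have h' : dist G w z t ≤ (D + D : ℝ≥0) := dist_le_add hD ((hS.le _ _).trans h)
    refine (dist_le_add ((hS.product 1 2 rfl z hz t ht).trans h') (dist_le_comm h)).trans
      (le_of_eq ?_)
    congr 1
    ring

/-- Two odd levels never sum to the odd number `k - 1`, so one side must change parity. The
one-level step at `y` does this: it gives `t` in `S 2`, from which `z` climbs to `s` in `S 4`.
Meanwhile `z'` climbs the odd levels to `q` in `S (2 * m + 1)`, and `4 + (2 * m + 1) = k - 1`. Any
link met earlier gives a shorter route. -/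
theorem dist_le_of_even {m : ℕ} (hS : HierarchyLinks G w H wH (2 * m + 6) S) {z z' y : V}
    {D b : ℝ≥0} (hz : z ∈ S 1) (hz' : z' ∈ S 1) (hD : dist G w z y ≤ D) (hb : dist H wH y z' ≤ b) :
    dist H wH z y ≤ (4 * D + (2 * m + 1) * (D + b) + b : ℝ≥0) := by
  have hD' : dist G w z z' ≤ (D + b : ℝ≥0) := dist_le_add hD ((hS.le _ _).trans hb)
  rcases hS.dist_le_or_exists_two (by omega) hz hD with h | ⟨t, ht, h⟩
  · refine h.trans (ENNReal.coe_le_coe.2 ?_)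
    rw [show 4 * D + (2 * m + 1) * (D + b) + b = D + (3 * D + (2 * m + 1) * (D + b) + b) by ring]
    exact le_self_add
  have ht' : dist G w z t ≤ (D + D : ℝ≥0) := dist_le_add hD ((hS.le _ _).trans h)
  rcases hS.step_two z hz 2 _ t (by omega) ht ht' with h₂ | ⟨s, hs, h₂⟩
  · refine (dist_le_add h₂ (dist_le_comm h)).trans (ENNReal.coe_le_coe.2 ?_)
    rw [show 4 * D + (2 * m + 1) * (D + b) + b
      = D + D + D + (D + (2 * m + 1) * (D + b) + b) by ring]
    exact le_self_add
  rcases hS.dist_le_or_exists_odd_level hz hz' hD' (N := m) (by omega) with h₃ | ⟨q, hq, h₃⟩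
  · refine (dist_le_add h₃ (dist_le_comm hb)).trans (ENNReal.coe_le_coe.2 ?_)
    rw [add_assoc]
    exact le_add_self
  · have h₄ : dist G w s q ≤ (D + D + (D + b + m * (D + b)) : ℝ≥0) :=
      dist_le_add (dist_le_comm ((hS.le _ _).trans h₂))
        (dist_le_add hD' ((hS.le _ _).trans h₃))
    have h₅ := (hS.product 4 (2 * m + 1) (by omega) s hs q hq).trans h₄
    refine (dist_le_add (dist_le_add h₂ h₅)
      (dist_le_add (dist_le_comm h₃) (dist_le_comm hb))).trans (le_of_eq ?_)
    congr 1
    ring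

theorem dist_le_of_walk (hS : HierarchyLinks G w H wH k S) {u v : V}
    (P : G.Walk u v) :
    dist H wH u v ≤ pathWeight w P ∨
    (∃ c, c ≤ heaviest w 1 P ∧ c ≤ pathWeight w P ∧
      dist H wH u v ≤ (pathWeight w P + 2 * (k - 1 : ℕ) * c : ℝ≥0)) ∨
    ∃ (A B C a b : ℝ≥0) (z z' y : V), z ∈ S 1 ∧ z' ∈ S 1 ∧ a ≤ heaviest w 1 P ∧
      b ≤ heaviest w 1 P ∧ a + b ≤ heaviest w 1 P + heaviest w 2 P ∧ pathWeight w P = A + a + B + b + C ∧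
      dist H wH u z ≤ (A + a : ℝ≥0) ∧ dist G w z y ≤ (2 * a + B + b : ℝ≥0) ∧
      dist H wH y v ≤ C ∧ dist H wH y z' ≤ b := by
  -- The complement of `L` consists of the heavy edges.
  set L : Set (Sym2 V) := {e | ∀ a b, e = s(a, b) → dist H wH a b ≤ w s(a, b)}
  have hL : ∀ {a b : V} (Q : G.Walk a b), (∀ e ∈ Q.edges, e ∈ L) →
      dist H wH a b ≤ pathWeight w Q :=
    fun Q hQ => dist_le_of_forall_edge Q fun a b hab => hQ _ hab a b rfl
  have hnL : ∀ {a b : V}, G.Adj a b → s(a, b) ∉ L → (∃ t ∈ S 1, dist H wH a t ≤ w s(a, b)) ∧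
      ∃ t ∈ S 1, dist H wH b t ≤ w s(a, b) := by
    intro a b hab hn
    refine (hS.edge a b hab).resolve_left fun h => hn fun a' b' he => ?_
    rw [← he]
    rcases Sym2.eq_iff.1 he with ⟨rfl, rfl⟩ | ⟨rfl, rfl⟩
    · exact h
    · exact dist_le_comm h
  rcases exists_first_notMem L P with h | ⟨x, x', P₁, hx, P₂, rfl, hP₁, hxL⟩
  · exact .inl (hL P h)
  right
  obtain ⟨z, hz, hxz⟩ := (hnL hx hxL).1
  have h₁ := hL P₁ hP₁
  -- Searching only behind the first heavy edge makes the two heavy edges distinct occurrences on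
  -- the path.
  rcases exists_last_notMem L P₂ with h | ⟨y', y, P₃, hy, P₄, rfl, hP₄, hyL⟩
  · left
    refine ⟨w s(x, x'), le_heaviest_one w (by simp), ?_, ?_⟩
    · rw [pathWeight_append, pathWeight_cons]
      exact le_self_add.trans le_add_self
    · refine (dist_le_add (dist_le_add h₁ (hS.dist_le_two_mul_sub_one (dist_le_of_adj w hx)))
        (hL P₂ h)).trans (le_of_eq ?_)
      rw [pathWeight_append, pathWeight_cons]
      congr 1
      ring
  · right
    obtain ⟨z', hz', hyz'⟩ := (hnL hy hyL).2
    refine ⟨pathWeight w P₁, pathWeight w P₃, pathWeight w P₄, w s(x, x'), w s(y', y), z, z', y,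
      hz, hz', le_heaviest_one w (by simp), le_heaviest_one w (by simp), add_le_heaviest w ?_, ?_,
      dist_le_add h₁ hxz, ?_, hL P₄ hP₄, hyz'⟩
    · simp only [SimpleGraph.Walk.edges_append, SimpleGraph.Walk.edges_cons]
      refine List.Sublist.trans ?_ (List.sublist_append_right _ _)
      refine List.Sublist.cons_cons _ (List.Sublist.trans ?_ (List.sublist_append_right _ _))
      simp
    · simp only [pathWeight_append, pathWeight_cons]
      ring
    · refine (dist_le_add (dist_le_add (dist_le_comm ((hS.le _ _).trans hxz))
        (dist_le_of_adj w hx)) (dist_le_add (dist_le_pathWeight G w P₃)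
        (dist_le_of_adj w hy))).trans (le_of_eq ?_)
      congr 1
      ring

end HierarchyLinks

end

/-! ### Stretch in terms of `W_1` and `W_2`, and its application to the construction -/

section

variable {V : Type*}

variable {G H : SimpleGraph V} {w wH : Sym2 V → ℝ≥0} {k : ℕ} {S : ℕ → Set V}

namespace HierarchyLinks

theorem exists_dist_le_of_even {m : ℕ} (hS : HierarchyLinks G w H wH (2 * (m + 1)) S) {u v : V}
    (P : G.Walk u v) :
    ∃ r : ℝ≥0, dist H wH u v ≤ r ∧ (r : ℝ) ≤ (2 * m + 1) * pathWeight w P +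
      2 * (m + 1) * heaviest w 1 P + max 0 (2 * ((m : ℝ) - 1)) * heaviest w 2 P := by
  have hd := (pathWeight w P).2
  have hW₁ := (heaviest w 1 P).2
  have hW₂ := (heaviest w 2 P).2
  have hm : (0 : ℝ) ≤ m := m.cast_nonneg
  have hmax : 0 ≤ max 0 (2 * ((m : ℝ) - 1)) * heaviest w 2 P := by positivity
  rcases hS.dist_le_of_walk P with h | ⟨c, hc₁, hcd, h⟩ |
    ⟨A, B, C, a, b, z, z', y, hz, hz', ha, hb, hab, hP, huz, hzy, hyv, hyz'⟩
  · refine ⟨_, h, ?_⟩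
    nlinarith [mul_nonneg hm hd, mul_nonneg hm hW₁]
  · refine ⟨_, h, ?_⟩
    -- The excess `(4m + 2)c` splits as `2m · c`, charged to the path weight, and `(2m + 2)c`,
    -- charged to `W_1`.
    rw [show 2 * (m + 1) - 1 = 2 * m + 1 by omega]
    push_cast
    rw [← NNReal.coe_le_coe] at hc₁ hcd
    nlinarith [mul_le_mul_of_nonneg_left hcd hm, mul_le_mul_of_nonneg_left hc₁ hm]
  · rw [hP]
    rw [← NNReal.coe_le_coe] at ha hab
    push_cast at hab
    have hA := A.2
    have hB := B.2
    have hC := C.2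
    have ha₀ := a.2
    have hb₀ := b.2
    rcases m with _ | _ | m
    · refine ⟨_, dist_le_add (dist_le_add huz (hS.dist_le_of_two hz hzy)) hyv, ?_⟩
      push_cast
      push_cast at hmax
      linarith
    · refine ⟨_, dist_le_add (dist_le_add huz (hS.dist_le_of_four hz hzy)) hyv, ?_⟩
      push_cast
      push_cast at hmax
      linarith
    · have hk : 2 * (m + 2 + 1) = 2 * m + 6 := by ring
      rw [show m + 1 + 1 = m + 2 from rfl, hk] at hS
      refine ⟨_, dist_le_add (dist_le_add huz (hS.dist_le_of_even hz hz' hzy hyz')) hyv, ?_⟩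
      push_cast at hm ⊢
      have hm' : (0 : ℝ) ≤ m := m.cast_nonneg
      rw [max_eq_right (by linarith)]
      -- Beyond the multiplicative part, `(2m + 2)(a + b) + 4a` remains, with `a + b ≤ W_1 + W_2`
      -- and `a ≤ W_1`.
      nlinarith [mul_nonneg hm' hA, mul_nonneg hm' hC, mul_le_mul_of_nonneg_left hab hm']

theorem exists_dist_le_of_odd {m : ℕ} (hS : HierarchyLinks G w H wH (2 * m + 3) S) {u v : V}
    (P : G.Walk u v) :
    ∃ r : ℝ≥0, dist H wH u v ≤ r ∧ (r : ℝ) ≤ (2 * m + 1) * pathWeight w P +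
      2 * (m + 2) * heaviest w 1 P + 2 * m * heaviest w 2 P := by
  have hd := (pathWeight w P).2
  have hW₁ := (heaviest w 1 P).2
  have hW₂ := (heaviest w 2 P).2
  have hm : (0 : ℝ) ≤ m := m.cast_nonneg
  rcases hS.dist_le_of_walk P with h | ⟨c, hc₁, hcd, h⟩ |
    ⟨A, B, C, a, b, z, z', y, hz, hz', ha, hb, hab, hP, huz, hzy, hyv, hyz'⟩
  · refine ⟨_, h, ?_⟩
    nlinarith [mul_nonneg hm hd, mul_nonneg hm hW₁, mul_nonneg hm hW₂]
  · refine ⟨_, h, ?_⟩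
    rw [show 2 * m + 3 - 1 = 2 * m + 2 by omega]
    push_cast
    rw [← NNReal.coe_le_coe] at hc₁ hcd
    nlinarith [mul_le_mul_of_nonneg_left hcd hm, mul_le_mul_of_nonneg_left hc₁ hm,
      mul_nonneg hm hW₂]
  · have hzz' := dist_le_add hzy ((hS.le _ _).trans hyz')
    refine ⟨_, dist_le_add (dist_le_add (dist_le_add huz (hS.dist_le_of_odd hz hz' hzz'))
      (dist_le_comm hyz')) hyv, ?_⟩
    rw [hP]
    rw [← NNReal.coe_le_coe] at ha hb hab
    push_cast at hab ⊢
    have hA := A.2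
    have hB := B.2
    have hC := C.2
    have ha₀ := a.2
    have hb₀ := b.2
    -- The remaining `(2m + 2)(a + b)` is at most `2m(W_1 + W_2) + 4W_1`.
    nlinarith [mul_nonneg hm hA, mul_nonneg hm hC, mul_le_mul_of_nonneg_left hab hm]

end HierarchyLinks

/-- The bounds hold for every walk; being shortest only turns its weight into the distance. -/
theorem isEmulator_of_forall {F : Set (Sym2 V)} {α : ℝ}
    {β : ∀ ⦃u v : V⦄, G.Walk u v → ℝ}
    (hle : ∀ u v, dist G w u v ≤ dist (SimpleGraph.fromEdgeSet F) wH u v)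
    (h : ∀ u v (P : G.Walk u v), ∃ r : ℝ≥0, dist (SimpleGraph.fromEdgeSet F) wH u v ≤ r ∧
      (r : ℝ) ≤ α * pathWeight w P + β P) :
    IsEmulator G w F wH α β := by
  refine fun u v => ⟨hle u v, fun P hP => ?_⟩
  obtain ⟨r, hr, hr'⟩ := h u v P
  rw [← hP]
  calc dist (SimpleGraph.fromEdgeSet F) wH u v ≤ r := hr
    _ = ENNReal.ofReal r := by simp
    _ ≤ ENNReal.ofReal (α * pathWeight w P + β P) := ENNReal.ofReal_le_ofReal hr'
    _ ≤ _ := ENNReal.ofReal_add_le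
    _ = _ := by rw [ENNReal.ofReal_mul' (pathWeight w P).coe_nonneg]; simp

theorem hierarchy_zero (k : ℕ) (ω : Coins k V) : hierarchy k ω 0 = Set.univ := by
  rw [hierarchy]

theorem mem_hierarchy_iff {ω : Coins k V} {i : ℕ} (hi : i ≤ k - 1) {v : V} :
    v ∈ hierarchy k ω i ↔ ∀ l : Fin (k - 1), (l : ℕ) < i → ω (l, v) = true := by
  induction i with
  | zero => simp [hierarchy]
  | succ i ih =>
    rw [hierarchy, Set.mem_ofPred_eq, ih (by omega)]
    constructor
    · rintro ⟨h, hi', h'⟩ l hl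
      rcases Nat.lt_succ_iff_lt_or_eq.1 hl with hl | rfl
      · exact h l hl
      · exact h'
    · exact fun h => ⟨fun l hl => h l (by omega), by omega, h _ (Nat.lt_succ_self i)⟩

theorem hierarchyLinks {p : Set V → V → V} (hp : IsPivotRule G w p) (hk : 2 ≤ k)
    (hS : ∀ v, v ∈ S 0) :
    HierarchyLinks G w (SimpleGraph.fromEdgeSet (emulatorEdges G w p k S)) (distWeight G w) k S := by
  have hstep : ∀ (A : Set V) (j : ℕ), 1 ≤ j →
      bunchEdges G w k S j A ⊆ (pivotEdges p k S ∪ lightEdges G w (S 1) ∪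
        bunchEdges G w k S 1 Set.univ ∪ bunchEdges G w k S 2 (S 1) ∪ productEdges k S) →
      ∀ x ∈ A, ∀ (l : ℕ) (r : ℝ≥0) (s : V), l + j ≤ k - 1 → s ∈ S l → dist G w x s ≤ r →
        dist (SimpleGraph.fromEdgeSet (emulatorEdges G w p k S)) (distWeight G w) x s ≤ r ∨
        ∃ t ∈ S (l + j),
          dist (SimpleGraph.fromEdgeSet (emulatorEdges G w p k S)) (distWeight G w) x t ≤ r := by
    intro A j hj hA x hx l r s hl hs hr
    by_cases hball : dist G w x s < distSet G w x (S (l + j))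
    · exact .inl ((dist_fromEdgeSet_le (hA ⟨x, hx, l, hl, s, ⟨hs, hball⟩, rfl⟩)).trans hr)
    · right
      obtain ⟨hne, hmem, hd⟩ := hp.exists_pivot ((not_lt.1 hball).trans hr)
      refine ⟨_, hmem, (dist_fromEdgeSet_le ?_).trans hd⟩
      exact .inl (.inl (.inl (.inl ⟨l + j, Finset.mem_Icc.2 ⟨by omega, hl⟩, hne, x, rfl⟩)))
  refine ⟨hS, dist_le_dist_fromEdgeSet Set.inter_subset_right, fun x l r s => ?_, fun x hx => ?_,
    fun i j hij a ha b hb => ?_, fun u v huv => ?_⟩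
  · exact hstep Set.univ 1 le_rfl (fun e he => .inl (.inl (.inr he))) x trivial l r s
  · exact hstep (S 1) 2 (by omega) (fun e he => .inl (.inr he)) x hx
  · refine dist_fromEdgeSet_le (.inr ⟨i + 1, Finset.mem_Icc.2 ⟨by omega, by omega⟩, a, ha, b, ?_,
      rfl⟩)
    rwa [show k - (i + 1) = j by omega]
  · have hpiv : ∀ x, distSet G w x (S 1) ≤ w s(u, v) → ∃ t ∈ S 1,
        dist (SimpleGraph.fromEdgeSet (emulatorEdges G w p k S)) (distWeight G w) x t
          ≤ w s(u, v) := by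
      intro x hx
      obtain ⟨hne, hmem, hd⟩ := hp.exists_pivot hx
      refine ⟨_, hmem, (dist_fromEdgeSet_le ?_).trans hd⟩
      exact .inl (.inl (.inl (.inl ⟨1, Finset.mem_Icc.2 ⟨le_rfl, by omega⟩, hne, x, rfl⟩)))
    by_cases he : s(u, v) ∈ lightEdges G w (S 1)
    · left
      exact (dist_fromEdgeSet_le (.inl (.inl (.inl (.inr he))))).trans (dist_le_of_adj w huv)
    · right
      refine ⟨hpiv u (not_lt.1 fun h => he ⟨u, v, rfl, huv, h⟩),
        hpiv v (not_lt.1 fun h => he ⟨v, u, Sym2.eq_swap, huv.symm, ?_⟩)⟩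
      rwa [Sym2.eq_swap]

theorem isEmulator_even {p : Set V → V → V} (hp : IsPivotRule G w p) (hS : ∀ v, v ∈ S 0) (m : ℕ) :
    IsEmulator G w (emulatorEdges G w p (2 * (m + 1)) S) (distWeight G w) (2 * m + 1)
      (fun _ _ P => 2 * (m + 1) * heaviest w 1 P
        + max 0 (2 * ((m : ℝ) - 1)) * heaviest w 2 P) := by
  have h := hierarchyLinks (k := 2 * (m + 1)) hp (by omega) hS
  refine isEmulator_of_forall h.le fun u v P => ?_
  obtain ⟨r, hr, hr'⟩ := h.exists_dist_le_of_even P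
  exact ⟨r, hr, hr'.trans_eq (add_assoc _ _ _)⟩

theorem isEmulator_odd {p : Set V → V → V} (hp : IsPivotRule G w p) (hS : ∀ v, v ∈ S 0) (m : ℕ) :
    IsEmulator G w (emulatorEdges G w p (2 * m + 3) S) (distWeight G w) (2 * m + 1)
      (fun _ _ P => 2 * (m + 2) * heaviest w 1 P + 2 * m * heaviest w 2 P) := by
  have h := hierarchyLinks (k := 2 * m + 3) hp (by omega) hS
  refine isEmulator_of_forall h.le fun u v P => ?_
  obtain ⟨r, hr, hr'⟩ := h.exists_dist_le_of_odd P
  exact ⟨r, hr, hr'.trans_eq (add_assoc _ _ _)⟩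

theorem isEmulator_floor_ceil {p : Set V → V → V} (hp : IsPivotRule G w p) (hk : 2 ≤ k)
    (hS : ∀ v, v ∈ S 0) :
    IsEmulator G w (emulatorEdges G w p k S) (distWeight G w) (2 * (⌊(k : ℝ) / 2⌋₊ : ℝ) - 1)
      (fun _ _ P => 2 * (⌈(k : ℝ) / 2⌉₊ : ℝ) * heaviest w 1 P
        + max 0 (2 * ((⌈(k : ℝ) / 2⌉₊ : ℝ) - 2)) * heaviest w 2 P) := by
  obtain ⟨m, rfl | rfl⟩ : ∃ m, k = 2 * (m + 1) ∨ k = 2 * m + 3 := by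
    rcases Nat.even_or_odd' k with ⟨n, rfl | rfl⟩
    · exact ⟨n - 1, by omega⟩
    · exact ⟨n - 1, by omega⟩
  · have e : ((2 * (m + 1) : ℕ) : ℝ) / 2 = (m + 1 : ℕ) := by
      push_cast
      ring
    rw [e, Nat.floor_natCast, Nat.ceil_natCast]
    convert isEmulator_even (m := m) hp hS using 6 <;> push_cast <;> ring_nf
  · have e₁ : ⌊((2 * m + 3 : ℕ) : ℝ) / 2⌋₊ = m + 1 := by
      rw [Nat.floor_eq_iff (by positivity)]
      push_cast
      constructor <;> linarith
    have e₂ : ⌈((2 * m + 3 : ℕ) : ℝ) / 2⌉₊ = m + 2 := by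
      rw [Nat.ceil_eq_iff (by omega)]
      push_cast [show m + 2 - 1 = m + 1 by omega]
      constructor <;> linarith
    rw [e₁, e₂]
    have hm : (0 : ℝ) ≤ m := m.cast_nonneg
    rw [max_eq_right (by push_cast; linarith)]
    convert isEmulator_odd (m := m) hp hS using 5 <;> push_cast <;> ring_nf

theorem isEmulator_sub_one {p : Set V → V → V} (hp : IsPivotRule G w p) (hk : 4 ≤ k)
    (hS : ∀ v, v ∈ S 0) (he : Even k) :
    IsEmulator G w (emulatorEdges G w p k S) (distWeight G w) ((k : ℝ) - 1)
      (fun _ _ P => (k : ℝ) * heaviest w 1 P + ((k : ℝ) - 4) * heaviest w 2 P) := by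
  obtain ⟨m, rfl⟩ : ∃ m, k = 2 * (m + 1 + 1) := by
    obtain ⟨n, rfl⟩ := he
    exact ⟨n - 2, by omega⟩
  have hm : (0 : ℝ) ≤ m := m.cast_nonneg
  have h := isEmulator_even (m := m + 1) hp hS
  rw [max_eq_right (by push_cast; linarith)] at h
  convert h using 5 <;> push_cast <;> ring_nf

theorem isEmulator_sub_two {p : Set V → V → V} (hp : IsPivotRule G w p) (hk : 2 ≤ k)
    (hS : ∀ v, v ∈ S 0) (ho : Odd k) :
    IsEmulator G w (emulatorEdges G w p k S) (distWeight G w) ((k : ℝ) - 2)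
      (fun _ _ P => ((k : ℝ) + 1) * heaviest w 1 P + ((k : ℝ) - 3) * heaviest w 2 P) := by
  obtain ⟨m, rfl⟩ : ∃ m, k = 2 * m + 3 := by
    obtain ⟨n, rfl⟩ := ho
    exact ⟨n - 1, by omega⟩
  convert isEmulator_odd (m := m) hp hS using 5 <;> push_cast <;> ring_nf

end

section

variable {V : Type*}

open MeasureTheory ProbabilityTheory

/-! ### Independent coins -/

/-- By `hB` the event `B` is determined by the coins outside `T`, which are independent of those in
`T`. -/
theorem pi_bernoulliMeasure_inter_forall_eq_true {ι : Type*} [Fintype ι] (q : unitInterval)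
    (T : Finset ι) (B : Set (ι → Bool))
    (hB : ∀ ω ω' : ι → Bool, (∀ t, t ∉ T → ω t = ω' t) → ω ∈ B → ω' ∈ B) :
    (Measure.pi fun _ : ι => bernoulliMeasure true false q) (B ∩ {ω | ∀ t ∈ T, ω t = true}) =
      (Measure.pi fun _ : ι => bernoulliMeasure true false q) B * ENNReal.ofReal q ^ T.card := by
  classical
  set μ : ι → Measure Bool := fun _ => bernoulliMeasure true false q
  have hind : iIndepFun (fun i (ω : ι → Bool) => id (ω i)) (Measure.pi μ) :=
    iIndepFun_pi fun i => aemeasurable_id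
  have h := hind.indepFun_finset Tᶜ T disjoint_compl_left fun i => measurable_pi_apply i
  have hB' : B = (fun (ω : ι → Bool) (i : (Tᶜ : Finset ι)) => id (ω i)) ⁻¹'
      ((fun (ω : ι → Bool) (i : (Tᶜ : Finset ι)) => id (ω i)) '' B) := by
    refine (Set.subset_preimage_image _ _).antisymm ?_
    rintro ω ⟨ω', hω', he⟩
    exact hB ω' ω (fun t ht => congrFun he ⟨t, Finset.mem_compl.2 ht⟩) hω'
  have hT : {ω : ι → Bool | ∀ t ∈ T, ω t = true} =
      (fun (ω : ι → Bool) (i : T) => id (ω i)) ⁻¹' {fun _ => true} := by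
    ext ω
    simp [funext_iff]
  have hT' : {ω : ι → Bool | ∀ t ∈ T, ω t = true} =
      Set.pi Set.univ fun t => if t ∈ T then {true} else Set.univ := by
    ext ω
    simp only [Set.mem_pi, Set.mem_univ, true_imp_iff]
    refine forall_congr' fun t => ?_
    by_cases ht : t ∈ T <;> simp [ht]
  have hμT : Measure.pi μ {ω : ι → Bool | ∀ t ∈ T, ω t = true} = ENNReal.ofReal q ^ T.card := by
    rw [hT', Measure.pi_pi]
    have : ∀ t, μ t (if t ∈ T then {true} else Set.univ) =
        if t ∈ T then ENNReal.ofReal q else 1 := by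
      intro t
      split_ifs
      · rw [bernoulliMeasure_apply_of_mem_of_notMem q (MeasurableSet.singleton true)
          (Set.mem_singleton true) (fun h => Bool.false_ne_true h)]
        rw [ENNReal.ofReal, Real.toNNReal_of_nonneg q.2.1]
        rfl
      · simp [μ]
    simp_rw [this]
    rw [Finset.prod_ite_mem]
    simp
  rw [← hμT, hT]
  nth_rewrite 1 [hB']
  rw [h.measure_inter_preimage_eq_mul _ _ (Set.toFinite _).measurableSet
    (Set.toFinite _).measurableSet, ← hB']

instance isProbabilityMeasure_coinLaw (k : ℕ) [Fintype V] : IsProbabilityMeasure (coinLaw k V) := by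
  unfold coinLaw
  infer_instance

theorem lintegral_ncard_le {Ω ι α : Type*} [MeasurableSpace Ω] [DiscreteMeasurableSpace Ω]
    (μ : Measure Ω) (Q : Finset ι) (R : Ω → ι → Prop) (f : Ω → ι → α) (E : Ω → Set α)
    (hE : ∀ ω, ∀ e ∈ E ω, ∃ x ∈ Q, R ω x ∧ e = f ω x) :
    ∫⁻ ω, ((E ω).ncard : ℝ≥0∞) ∂μ ≤ ∑ x ∈ Q, μ {ω | R ω x} := by
  classical
  calc ∫⁻ ω, ((E ω).ncard : ℝ≥0∞) ∂μ
      ≤ ∫⁻ ω, ∑ x ∈ Q, ({ω | R ω x}.indicator 1 ω : ℝ≥0∞) ∂μ := by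
        refine lintegral_mono fun ω => ?_
        have hsub : E ω ⊆ ((Q.filter (R ω)).image (f ω) : Finset α) := by
          intro e he
          obtain ⟨x, hx, hR, rfl⟩ := hE ω e he
          exact Finset.mem_coe.2 (Finset.mem_image_of_mem _ (Finset.mem_filter.2 ⟨hx, hR⟩))
        have hcard : (E ω).ncard ≤ (Q.filter (R ω)).card := by
          refine (Set.ncard_le_ncard hsub (Finset.finite_toSet _)).trans ?_
          rw [Set.ncard_coe_finset]
          exact Finset.card_image_le
        refine (Nat.cast_le.2 hcard).trans (le_of_eq ?_)
        rw [Finset.card_filter]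
        push_cast
        refine Finset.sum_congr rfl fun x _ => ?_
        simp [Set.indicator_apply]
    _ = ∑ x ∈ Q, μ {ω | R ω x} := by
        rw [lintegral_finsetSum _ fun x _ => Measurable.of_discrete]
        refine Finset.sum_congr rfl fun x _ => ?_
        rw [lintegral_indicator_one (MeasurableSet.of_discrete)]

/-! ### Expected size -/

variable {k : ℕ}

/-- The coins of the vertex `s` at the levels `i + 1, …, i + j`. -/
def levelCoins (k i j : ℕ) (s : V) : Finset (Fin (k - 1) × V) :=
  (Finset.univ.filter fun l : Fin (k - 1) => i ≤ l ∧ (l : ℕ) < i + j) ×ˢ {s}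

theorem mem_levelCoins {i j : ℕ} {s : V} {t : Fin (k - 1) × V} :
    t ∈ levelCoins k i j s ↔ (i ≤ t.1 ∧ (t.1 : ℕ) < i + j) ∧ t.2 = s := by
  simp only [levelCoins, Finset.mem_product, Finset.mem_filter, Finset.mem_univ, true_and,
    Finset.mem_singleton]

theorem card_levelCoins {i j : ℕ} (h : i + j ≤ k - 1) (s : V) :
    (levelCoins k i j s).card = j := by
  rw [levelCoins, Finset.card_product, Finset.card_singleton, mul_one,
    ← Finset.card_map Fin.valEmbedding]
  have : (Finset.univ.filter fun l : Fin (k - 1) => i ≤ l ∧ (l : ℕ) < i + j).map Fin.valEmbedding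
      = Finset.Ico i (i + j) := by
    ext a
    simp only [Finset.mem_map, Finset.mem_filter, Finset.mem_univ, true_and,
      Fin.valEmbedding_apply, Finset.mem_Ico]
    constructor
    · rintro ⟨l, hl, rfl⟩
      exact hl
    · exact fun ha => ⟨⟨a, by omega⟩, ha, rfl⟩
  rw [this]
  simp

theorem mem_hierarchy_of_mem {ω : Coins k V} {i j : ℕ} (h : i + j ≤ k - 1) {s : V}
    (hs : s ∈ hierarchy k ω i) (hT : ∀ t ∈ levelCoins k i j s, ω t = true) :
    s ∈ hierarchy k ω (i + j) := by
  rw [mem_hierarchy_iff h]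
  rw [mem_hierarchy_iff (by omega)] at hs
  intro l hl
  by_cases hli : (l : ℕ) < i
  · exact hs l hli
  · exact hT _ (mem_levelCoins.2 ⟨⟨not_lt.1 hli, hl⟩, rfl⟩)

theorem mem_hierarchy_congr {ω ω' : Coins k V} {i : ℕ} (hi : i ≤ k - 1) {s : V}
    (h : ∀ l : Fin (k - 1), (l : ℕ) < i → ω (l, s) = ω' (l, s)) :
    s ∈ hierarchy k ω i ↔ s ∈ hierarchy k ω' i := by
  rw [mem_hierarchy_iff hi, mem_hierarchy_iff hi]
  exact forall₂_congr fun l hl => by rw [h l hl]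

variable [Fintype V]

/-- The probability with which a vertex passes to the next level of the hierarchy. -/
noncomputable abbrev levelProb (k : ℕ) (V : Type*) [Fintype V] : ℝ≥0∞ :=
  ENNReal.ofReal (samplingProb (Fintype.card V) k)

theorem coinLaw_inter_forall_eq_true (T : Finset (Fin (k - 1) × V)) (B : Set (Coins k V))
    (hB : ∀ ω ω' : Coins k V, (∀ t, t ∉ T → ω t = ω' t) → ω ∈ B → ω' ∈ B) :
    coinLaw k V (B ∩ {ω | ∀ t ∈ T, ω t = true}) = coinLaw k V B * levelProb k V ^ T.card :=
  pi_bernoulliMeasure_inter_forall_eq_true _ T B hB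

theorem coinLaw_forall_eq_true (T : Finset (Fin (k - 1) × V)) :
    coinLaw k V {ω | ∀ t ∈ T, ω t = true} = levelProb k V ^ T.card := by
  simpa using coinLaw_inter_forall_eq_true T Set.univ (fun _ _ _ _ => trivial)

theorem sum_coinLaw_mul_le {L : Type*} [LinearOrder L] {ρ : V → L} (hρ : Function.Injective ρ)
    {i j : ℕ} (hij : i + j ≤ k - 1) (U : Set (Coins k V)) (Q : Finset V)
    (hU : ∀ s ∈ Q, ∀ ω ω' : Coins k V, (∀ t, t ∉ levelCoins k i j s → ω t = ω' t) →
      ω ∈ U → ω' ∈ U) :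
    (∑ s ∈ Q, coinLaw k V {ω | ω ∈ U ∧ s ∈ hierarchy k ω i ∧
      ∀ s', ρ s' ≤ ρ s → s' ∉ hierarchy k ω (i + j)}) * levelProb k V ^ j ≤ coinLaw k V U := by
  set B : V → Set (Coins k V) := fun s => {ω | ω ∈ U ∧ s ∈ hierarchy k ω i ∧
      ∀ s', ρ s' < ρ s → s' ∉ hierarchy k ω (i + j)}
  have hB : ∀ s ∈ Q, coinLaw k V (B s ∩ {ω | ∀ t ∈ levelCoins k i j s, ω t = true}) =
      coinLaw k V (B s) * levelProb k V ^ j := by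
    intro s hs
    rw [coinLaw_inter_forall_eq_true, card_levelCoins hij]
    rintro ω ω' h ⟨h₁, h₂, h₃⟩
    refine ⟨hU s hs ω ω' h h₁, ?_, fun s' hs' => ?_⟩
    · refine (mem_hierarchy_congr (by omega) fun l hl => h _ fun hm => ?_).1 h₂
      exact hl.not_ge (mem_levelCoins.1 hm).1.1
    · refine fun hm => h₃ s' hs' ((mem_hierarchy_congr hij fun l hl => h _ fun hm => ?_).2 hm)
      have := (mem_levelCoins.1 hm).2
      subst this
      exact lt_irrefl _ hs'
  rw [Finset.sum_mul]
  calc ∑ s ∈ Q, coinLaw k V {ω | ω ∈ U ∧ s ∈ hierarchy k ω i ∧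
        ∀ s', ρ s' ≤ ρ s → s' ∉ hierarchy k ω (i + j)} * levelProb k V ^ j
      ≤ ∑ s ∈ Q, coinLaw k V (B s ∩ {ω | ∀ t ∈ levelCoins k i j s, ω t = true}) := by
        refine Finset.sum_le_sum fun s hs => ?_
        rw [hB s hs]
        gcongr
        -- Relaxing `≤` to `<` drops the condition on `s` itself, which would involve its coins.
        exact fun ω h => ⟨h.1, h.2.1, fun s' hs' => h.2.2 s' hs'.le⟩
    _ = coinLaw k V (⋃ s ∈ Q, B s ∩ {ω | ∀ t ∈ levelCoins k i j s, ω t = true}) := by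
        refine (measure_biUnion_finset ?_ fun _ _ => MeasurableSet.of_discrete).symm
        have key : ∀ s s' ω, ρ s < ρ s' →
            ω ∈ B s ∩ {ω | ∀ t ∈ levelCoins k i j s, ω t = true} → ω ∉ B s' :=
          fun s s' ω hlt h h' => h'.2.2 s hlt (mem_hierarchy_of_mem hij h.1.2.1 h.2)
        intro s _ s' _ hne
        refine Set.disjoint_left.2 fun ω h h' => ?_
        rcases lt_or_gt_of_ne (hρ.ne hne) with hlt | hlt
        · exact key _ _ ω hlt h h'.1
        · exact key _ _ ω hlt h' h.1
    _ ≤ coinLaw k V U := by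
        refine measure_mono (Set.iUnion₂_subset fun s _ ω h => h.1.1)

/-- Equal distances are separated by an enumeration of `V`, so that a first sampled vertex is
unique. -/
theorem exists_linearOrder_rank (d : V → ℝ≥0∞) :
    ∃ ρ : V → ℝ≥0∞ ×ₗ Fin (Fintype.card V), Function.Injective ρ ∧
      ∀ s s', ρ s' ≤ ρ s → d s' ≤ d s := by
  refine ⟨fun s => toLex (d s, Fintype.equivFin V s), fun s s' h => ?_, fun s s' h => ?_⟩
  · have := congrArg (fun x => (ofLex x).2) h
    exact (Fintype.equivFin V).injective this
  · rcases Prod.Lex.toLex_le_toLex.1 h with h | h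
    · exact h.le
    · exact h.1.le

theorem sum_coinLaw_ball_le (G : SimpleGraph V) (w : Sym2 V → ℝ≥0) {X : ℝ≥0∞}
    (hX : levelProb k V * X = 1) {i j : ℕ} (hij : i + j ≤ k - 1) (u : V) (U : Set (Coins k V))
    (hU : ∀ s, s ≠ u → ∀ ω ω' : Coins k V, (∀ t, t ∉ levelCoins k i j s → ω t = ω' t) →
      ω ∈ U → ω' ∈ U) :
    ∑ s, coinLaw k V {ω | ω ∈ U ∧ s ∈ ball G w u (hierarchy k ω i) (hierarchy k ω (i + j))} ≤
      coinLaw k V U * (X ^ j + 1) := by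
  classical
  obtain ⟨ρ, hρ, hρd⟩ := exists_linearOrder_rank (dist G w u)
  have h := sum_coinLaw_mul_le hρ hij U (Finset.univ.erase u)
    fun s hs => hU s (Finset.ne_of_mem_erase hs)
  -- The event `U` may depend on the coins of `u`, as `u ∈ S_1` does, so the term `s = u` is split
  -- off; it gives the `+ 1`.
  rw [← Finset.sum_erase_add _ _ (Finset.mem_univ u), mul_add, mul_one]
  refine add_le_add ?_ (measure_mono fun ω h => h.1)
  refine (Finset.sum_le_sum fun s _ => measure_mono (t := {ω | ω ∈ U ∧ s ∈ hierarchy k ω i ∧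
      ∀ s', ρ s' ≤ ρ s → s' ∉ hierarchy k ω (i + j)}) ?_).trans ?_
  · rintro ω ⟨h₁, h₂, h₃⟩
    exact ⟨h₁, h₂, fun s' hs' hm => absurd (h₃.trans_le (distSet_le hm)) (hρd s s' hs').not_gt⟩
  · refine le_trans (le_of_eq ?_) (mul_le_mul_left h (X ^ j))
    rw [mul_assoc, ← mul_pow, hX, one_pow, mul_one]

theorem lintegral_bunchEdges_le (G : SimpleGraph V) (w : Sym2 V → ℝ≥0) {X c : ℝ≥0∞}
    (hX : levelProb k V * X = 1) {j : ℕ} (hj : 1 ≤ j) (A : Coins k V → Set V)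
    (hA : ∀ u, coinLaw k V {ω | u ∈ A ω} ≤ c)
    (hU : ∀ i u s, s ≠ u → ∀ ω ω' : Coins k V, (∀ t, t ∉ levelCoins k i j s → ω t = ω' t) →
      u ∈ A ω → u ∈ A ω') :
    ∫⁻ ω, ((bunchEdges G w k (hierarchy k ω) j (A ω)).ncard : ℝ≥0∞) ∂(coinLaw k V) ≤
      k * Fintype.card V * (c * (X ^ j + 1)) := by
  refine (lintegral_ncard_le _ (((Finset.range k).filter fun i => i + j ≤ k - 1) ×ˢ
    (Finset.univ : Finset V) ×ˢ (Finset.univ : Finset V))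
    (fun ω x => x.2.1 ∈ A ω ∧
      x.2.2 ∈ ball G w x.2.1 (hierarchy k ω x.1) (hierarchy k ω (x.1 + j)))
    (fun _ x => s(x.2.1, x.2.2)) _ ?_).trans ?_
  · rintro ω e ⟨u, hu, i, hi, s, hs, rfl⟩
    refine ⟨(i, u, s), ?_, ⟨hu, hs⟩, rfl⟩
    simp only [Finset.mem_product, Finset.mem_filter, Finset.mem_range, Finset.mem_univ, and_true]
    exact ⟨by omega, hi⟩
  · rw [Finset.sum_product]
    simp_rw [Finset.sum_product]
    calc _ ≤ ∑ i ∈ (Finset.range k).filter fun i => i + j ≤ k - 1, ∑ _u : V, c * (X ^ j + 1) := by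
          refine Finset.sum_le_sum fun i hi => Finset.sum_le_sum fun u _ => ?_
          refine (sum_coinLaw_ball_le G w hX (Finset.mem_filter.1 hi).2 u {ω | u ∈ A ω}
            (hU i u)).trans ?_
          gcongr
          exact hA u
      _ ≤ _ := by
          rw [Finset.sum_const, Finset.sum_const, Finset.card_univ, nsmul_eq_mul, nsmul_eq_mul,
            ← mul_assoc]
          gcongr
          exact (Finset.card_filter_le _ _).trans (Finset.card_range k).le

end

/-! ### Expected sizes of the parts of the emulator -/

section

variable {V : Type*}

open MeasureTheory ProbabilityTheory

variable {k : ℕ}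

theorem mem_hierarchy_iff_forall_levelCoins {ω : Coins k V} {i : ℕ} (hi : i ≤ k - 1) {v : V} :
    v ∈ hierarchy k ω i ↔ ∀ t ∈ levelCoins k 0 i v, ω t = true := by
  rw [mem_hierarchy_iff hi]
  constructor
  · rintro h ⟨l, v⟩ ht
    obtain ⟨⟨-, hl⟩, rfl⟩ := mem_levelCoins.1 ht
    exact h l (by simpa using hl)
  · exact fun h l hl => h _ (mem_levelCoins.2 ⟨⟨Nat.zero_le _, by simpa using hl⟩, rfl⟩)

/-- A light edge falls under level `i = 0` of `B_1(V)`, so `E_1` needs no count of its own. -/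
theorem lightEdges_subset_bunchEdges (G : SimpleGraph V) (w : Sym2 V → ℝ≥0) (hk : 2 ≤ k)
    {S : ℕ → Set V} (hS : ∀ v, v ∈ S 0) :
    lightEdges G w (S 1) ⊆ bunchEdges G w k S 1 Set.univ := by
  rintro e ⟨u, v, rfl, huv, h⟩
  exact ⟨u, trivial, 0, by omega, v, ⟨hS v, (dist_le_of_adj w huv).trans_lt (by simpa using h)⟩,
    rfl⟩

variable [Fintype V]

theorem coinLaw_mem_hierarchy {i : ℕ} (hi : i ≤ k - 1) (u : V) :
    coinLaw k V {ω | u ∈ hierarchy k ω i} = levelProb k V ^ i := by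
  have h := coinLaw_forall_eq_true (levelCoins k 0 i u)
  rw [card_levelCoins (by omega)] at h
  rw [← h]
  congr 1
  ext ω
  exact mem_hierarchy_iff_forall_levelCoins hi

theorem coinLaw_mem_hierarchy_and_mem {i j : ℕ} (hi : i ≤ k - 1) (hj : j ≤ k - 1) {u v : V}
    (huv : u ≠ v) :
    coinLaw k V {ω | u ∈ hierarchy k ω i ∧ v ∈ hierarchy k ω j} = levelProb k V ^ (i + j) := by
  have h := coinLaw_inter_forall_eq_true (levelCoins k 0 j v) {ω : Coins k V | u ∈ hierarchy k ω i}
    (fun ω ω' h hm => (mem_hierarchy_congr hi fun l _ => h _ fun ht =>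
      huv (mem_levelCoins.1 ht).2).1 hm)
  rw [card_levelCoins (by omega), coinLaw_mem_hierarchy hi, ← pow_add] at h
  rw [← h]
  congr 1
  ext ω
  exact and_congr_right fun _ => mem_hierarchy_iff_forall_levelCoins hj

theorem lintegral_pivotEdges_le (p : Set V → V → V) :
    ∫⁻ ω, ((pivotEdges p k (hierarchy k ω)).ncard : ℝ≥0∞) ∂(coinLaw k V) ≤
      k * Fintype.card V := by
  refine (lintegral_ncard_le _ (Finset.Icc 1 (k - 1) ×ˢ (Finset.univ : Finset V))
    (fun _ _ => True) (fun ω x => s(x.2, p (hierarchy k ω x.1) x.2)) _ ?_).trans ?_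
  · rintro ω e ⟨i, hi, -, u, rfl⟩
    exact ⟨(i, u), Finset.mem_product.2 ⟨hi, Finset.mem_univ u⟩, trivial, rfl⟩
  · refine (Finset.sum_le_sum fun _ _ => prob_le_one).trans ?_
    rw [Finset.sum_const, Finset.card_product, Nat.card_Icc, Finset.card_univ, nsmul_one,
      Nat.cast_mul]
    gcongr
    simp

theorem lintegral_productEdges_le {X : ℝ≥0∞} (hX : levelProb k V * X = 1)
    (hXk : X ^ k = Fintype.card V) (hk : 1 ≤ k) :
    ∫⁻ ω, ((productEdges k (hierarchy k ω)).ncard : ℝ≥0∞) ∂(coinLaw k V) ≤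
      k * Fintype.card V * (X + 1) := by
  classical
  refine (lintegral_ncard_le _ (Finset.Icc 1 k ×ˢ
    (Finset.univ : Finset V) ×ˢ (Finset.univ : Finset V))
    (fun ω x => x.2.1 ∈ hierarchy k ω (x.1 - 1) ∧ x.2.2 ∈ hierarchy k ω (k - x.1))
    (fun _ x => s(x.2.1, x.2.2)) _ ?_).trans ?_
  · rintro ω e ⟨i, hi, u, hu, v, hv, rfl⟩
    exact ⟨(i, u, v), by simpa using hi, ⟨hu, hv⟩, rfl⟩
  · rw [Finset.sum_product]
    simp_rw [Finset.sum_product]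
    -- For each `u`, every `v ≠ u` contributes `q^{k-1}`, and `n q^{k-1} = X`; the diagonal pair
    -- contributes at most `1`.
    have hq : levelProb k V ^ (k - 1) * Fintype.card V = X := by
      obtain ⟨m, rfl⟩ : ∃ m, k = m + 1 := ⟨k - 1, by omega⟩
      rw [← hXk, Nat.add_sub_cancel, pow_succ, ← mul_assoc, ← mul_pow, hX, one_pow, one_mul]
    calc _ ≤ ∑ i ∈ Finset.Icc 1 k, ∑ _u : V, (X + 1) := by
          refine Finset.sum_le_sum fun i hi => Finset.sum_le_sum fun u _ => ?_
          rw [Finset.mem_Icc] at hi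
          rw [← Finset.sum_erase_add _ _ (Finset.mem_univ u)]
          refine add_le_add ?_ prob_le_one
          rw [Finset.sum_congr rfl fun v hv => coinLaw_mem_hierarchy_and_mem (i := i - 1)
            (j := k - i) (by omega) (by omega) (Finset.ne_of_mem_erase hv).symm,
            Finset.sum_const, nsmul_eq_mul, show i - 1 + (k - i) = k - 1 by omega, mul_comm]
          refine le_trans ?_ hq.le
          gcongr
          exact Finset.card_le_univ _
      _ = _ := by
          rw [Finset.sum_const, Finset.sum_const, Finset.card_univ, nsmul_eq_mul, nsmul_eq_mul,
            ← mul_assoc, Nat.card_Icc, Nat.add_sub_cancel]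

theorem ncard_emulatorEdges_le (G : SimpleGraph V) (w : Sym2 V → ℝ≥0) (p : Set V → V → V)
    (hk : 2 ≤ k) {S : ℕ → Set V} (hS : ∀ v, v ∈ S 0) :
    (emulatorEdges G w p k S).ncard ≤ (pivotEdges p k S).ncard +
      (bunchEdges G w k S 1 Set.univ).ncard + (bunchEdges G w k S 2 (S 1)).ncard +
      (productEdges k S).ncard := by
  have hsub : emulatorEdges G w p k S ⊆ pivotEdges p k S ∪ bunchEdges G w k S 1 Set.univ ∪
      bunchEdges G w k S 2 (S 1) ∪ productEdges k S := by
    rintro e ⟨(((he | he) | he) | he) | he, -⟩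
    · exact .inl (.inl (.inl he))
    · exact .inl (.inl (.inr (lightEdges_subset_bunchEdges G w hk hS he)))
    · exact .inl (.inl (.inr he))
    · exact .inl (.inr he)
    · exact .inr he
  refine (Set.ncard_le_ncard hsub (Set.toFinite _)).trans ((Set.ncard_union_le _ _).trans ?_)
  gcongr
  refine (Set.ncard_union_le _ _).trans ?_
  gcongr
  exact Set.ncard_union_le _ _

theorem lintegral_ncard_emulatorEdges_le_of_mul_eq_one (G : SimpleGraph V) (w : Sym2 V → ℝ≥0)
    (p : Set V → V → V) (hk : 2 ≤ k) {X : ℝ≥0∞} (hX : levelProb k V * X = 1)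
    (hXk : X ^ k = Fintype.card V) (hX₁ : 1 ≤ X) :
    ∫⁻ ω, ((emulatorEdges G w p k (hierarchy k ω)).ncard : ℝ≥0∞) ∂(coinLaw k V) ≤
      7 * k * (Fintype.card V * X) := by
  have hB₁ := lintegral_bunchEdges_le G w hX le_rfl (fun _ : Coins k V => Set.univ) (c := 1)
    (fun _ => prob_le_one) (fun _ _ _ _ _ _ _ _ => trivial)
  have hB₂ := lintegral_bunchEdges_le G w hX one_le_two (fun ω : Coins k V => hierarchy k ω 1)
    (c := levelProb k V) (fun u => by rw [coinLaw_mem_hierarchy (by omega), pow_one])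
    (fun i u s hs ω ω' h hm => (mem_hierarchy_congr (by omega) fun l _ => h _ fun ht =>
      hs (mem_levelCoins.1 ht).2.symm).1 hm)
  have hq : levelProb k V ≤ 1 :=
    ENNReal.ofReal_le_one.2 (samplingProb (Fintype.card V) k).2.2
  calc _ ≤ ∫⁻ ω, (((pivotEdges p k (hierarchy k ω)).ncard : ℝ≥0∞) +
        ((bunchEdges G w k (hierarchy k ω) 1 Set.univ).ncard : ℝ≥0∞) +
        ((bunchEdges G w k (hierarchy k ω) 2 (hierarchy k ω 1)).ncard : ℝ≥0∞) +
        ((productEdges k (hierarchy k ω)).ncard : ℝ≥0∞)) ∂(coinLaw k V) := by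
        refine lintegral_mono fun ω => ?_
        have h := ncard_emulatorEdges_le G w p hk (S := hierarchy k ω)
          fun v => by simp [hierarchy_zero]
        refine (Nat.cast_le.2 h).trans (le_of_eq ?_)
        push_cast
        rfl
    _ ≤ k * Fintype.card V + k * Fintype.card V * (1 * (X ^ 1 + 1)) +
        k * Fintype.card V * (levelProb k V * (X ^ 2 + 1)) + k * Fintype.card V * (X + 1) := by
        rw [lintegral_add_right _ Measurable.of_discrete,
          lintegral_add_right _ Measurable.of_discrete,
          lintegral_add_right _ Measurable.of_discrete]
        gcongr
        · exact lintegral_pivotEdges_le p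
        · exact lintegral_productEdges_le hX hXk (by omega)
    _ = k * Fintype.card V * (1 + (X + 1) + (levelProb k V * X * X + levelProb k V) + (X + 1)) := by
        ring
    -- Since `q * X = 1`, the factor `q` from `u ∈ S_1` lowers the `X ^ 2` of `B_2` to `X`. Each
    -- remaining `1` or `q` is at most `X`, whence the constant `7`.
    _ ≤ k * Fintype.card V * (X + (X + X) + (1 * X + X) + (X + X)) := by
        rw [hX]
        gcongr
        exact hq.trans hX₁
    _ = _ := by ring

theorem lintegral_ncard_emulatorEdges_le (G : SimpleGraph V) (w : Sym2 V → ℝ≥0)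
    (p : Set V → V → V) (hk : 2 ≤ k) :
    ∫⁻ ω, ((emulatorEdges G w p k (hierarchy k ω)).ncard : ℝ≥0∞) ∂(coinLaw k V) ≤
      ENNReal.ofReal (7 * k * (Fintype.card V : ℝ) ^ (1 + 1 / (k : ℝ))) := by
  -- For `n = 0` the sampling probability is `0` and has no inverse `X`.
  rcases isEmpty_or_nonempty V with hV | hV
  · have : ∀ ω : Coins k V, emulatorEdges G w p k (hierarchy k ω) = ∅ := by
      refine fun ω => Set.eq_empty_of_forall_notMem fun e _ => ?_
      induction e with
      | _ u v => exact hV.elim u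
    simp [this]
  have hn : (0 : ℝ) < Fintype.card V := Nat.cast_pos.2 Fintype.card_pos
  have hn₁ : (1 : ℝ) ≤ Fintype.card V := Nat.one_le_cast.2 Fintype.card_pos
  have hk₀ : (k : ℝ) ≠ 0 := by
    have : k ≠ 0 := by omega
    exact_mod_cast this
  refine (lintegral_ncard_emulatorEdges_le_of_mul_eq_one G w p hk
    (X := ENNReal.ofReal ((Fintype.card V : ℝ) ^ (1 / (k : ℝ)))) ?_ ?_ ?_).trans (le_of_eq ?_)
  · rw [levelProb, ← ENNReal.ofReal_mul (samplingProb _ k).2.1, samplingProb, ← Real.rpow_add hn]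
    simp
  · rw [← ENNReal.ofReal_pow (by positivity), ← Real.rpow_natCast, ← Real.rpow_mul hn.le,
      one_div_mul_cancel hk₀, Real.rpow_one, ENNReal.ofReal_natCast]
  · exact ENNReal.one_le_ofReal.2 (Real.one_le_rpow hn₁ (by positivity))
  · rw [Real.rpow_add hn, Real.rpow_one, ENNReal.ofReal_mul (by positivity),
      ENNReal.ofReal_mul (by positivity), ENNReal.ofReal_mul (by positivity)]
    simp

end

end Emulator

theorem mainTheorem1 :
    ∃ (C : ℝ) (c : ℕ), 0 < C ∧
      ∀ (k : ℕ), 2 ≤ k →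
      ∀ (V : Type*) [Fintype V] (G : SimpleGraph V) (w : Sym2 V → ℝ≥0) (p : Set V → V → V),
        Emulator.IsPivotRule G w p →
        -- every outcome of the sampling gives an emulator with the stated stretch
        (∀ ω : Emulator.Coins k V,
          Emulator.IsEmulator G w
            (Emulator.emulatorEdges G w p k (Emulator.hierarchy k ω)) (Emulator.distWeight G w)
            (2 * (⌊(k : ℝ) / 2⌋₊ : ℝ) - 1)
            (fun _ _ P => 2 * (⌈(k : ℝ) / 2⌉₊ : ℝ) * Emulator.heaviest w 1 P
              + max 0 (2 * ((⌈(k : ℝ) / 2⌉₊ : ℝ) - 2)) * Emulator.heaviest w 2 P) ∧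
          -- the same stretch, written out for even and for odd `k`
          (Even k → 4 ≤ k →
            Emulator.IsEmulator G w
              (Emulator.emulatorEdges G w p k (Emulator.hierarchy k ω)) (Emulator.distWeight G w)
              ((k : ℝ) - 1)
              (fun _ _ P => (k : ℝ) * Emulator.heaviest w 1 P
                + ((k : ℝ) - 4) * Emulator.heaviest w 2 P)) ∧
          (Odd k →
            Emulator.IsEmulator G w
              (Emulator.emulatorEdges G w p k (Emulator.hierarchy k ω)) (Emulator.distWeight G w)
              ((k : ℝ) - 2)
              (fun _ _ P => ((k : ℝ) + 1) * Emulator.heaviest w 1 P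
                + ((k : ℝ) - 3) * Emulator.heaviest w 2 P))) ∧
        -- the expected number of edges
        ∫⁻ ω, ((Emulator.emulatorEdges G w p k (Emulator.hierarchy k ω)).ncard : ℝ≥0∞)
            ∂(Emulator.coinLaw k V) ≤
          ENNReal.ofReal (C * k * (1 + Real.log (Fintype.card V)) ^ c
            * (Fintype.card V : ℝ) ^ (1 + 1 / (k : ℝ))) := by
  -- No logarithmic factor is needed, so the exponent is `0`.
  refine ⟨7, 0, by norm_num, fun k hk V _ G w p hp => ⟨fun ω => ?_, ?_⟩⟩
  · have hS : ∀ v, v ∈ Emulator.hierarchy k ω 0 := fun v => by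
      rw [Emulator.hierarchy_zero]
      trivial
    exact ⟨Emulator.isEmulator_floor_ceil hp hk hS,
      fun he hk' => Emulator.isEmulator_sub_one hp hk' hS he,
      Emulator.isEmulator_sub_two hp hk hS⟩
  · rw [pow_zero, mul_one]
    exact Emulator.lintegral_ncard_emulatorEdges_le G w p hk
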